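/- Let $\mathcal H$ be a complex Hilbert space. Let $\mathcal B(\mathcal H)$, $\mathcal K(\mathcal H)$ and $\mathcal L^1(\mathcal H)$ denote the bounded, compact and trace class operators on $\mathcal H$, let $\|\cdot\|$ be the operator norm and $\|x\|_1=\mathrm{Tr}\,|x|$ the trace norm. Let $\mathcal V$ be a finite-dimensional subspace of $\mathcal L^1(\mathcal H)$ with $\dim\mathcal V=n$, and let $x\in\mathcal L^1(\mathcal H)\setminus\mathcal V$. Put $$N_{\mathcal V}=\{a\in\mathcal B(\mathcal H):\ \mathrm{Tr}(ay)=0\ \text{for all } y\in\mathcal V\},\qquad \mathrm{dist}_1(x,\mathcal V)=\inf_{v\in\mathcal V}\|x-v\|_1 .$$ Then $$\mathrm{dist}_1(x,\mathcal V)=\sup\{|\mathrm{Tr}(ax)|:\ a\in\mathcal K(\mathcal H)\cap N_{\mathcal V},\ \|a\|=1\}=\max\{|\mathrm{Tr}(ax)|:\ a\in N_{\mathcal V},\ \|a\|=1\},$$ where the maximum is attained. Moreover, there exist an integer $k$ with $1\le k\le 2n+1$ and scalars $\lambda_1,\dots,\lambda_k\in[0,1]$ with $\sum_{i=1}^k\lambda_i=1$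 such that $$\mathrm{dist}_1(x,\mathcal V)=\max_{(u_1,\dots,u_k)}\ \sum_{i=1}^k\lambda_i\,\mathrm{Tr}(u_ix),$$ where the maximum is attained and is taken over all $k$-tuples $(u_1,\dots,u_k)\in\mathcal B(\mathcal H)^k$ such that, for each $i$, $u_i^*u_i=\mathrm{Id}_{\mathcal H}$ or $u_iu_i^*=\mathrm{Id}_{\mathcal H}$; $\mathrm{Im}\sum_{i=1}^k\lambda_i\mathrm{Tr}(u_ix)=0$; and $\sum_{i=1}^k\lambda_i\mathrm{Tr}(u_iv)=0$ for all $v\in\mathcal V$. -/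

import Mathlib

noncomputable section

namespace TraceDist

variable {H : Type*} [NormedAddCommGroup H] [InnerProductSpace ℂ H] [CompleteSpace H]

/-- The index set of a fixed orthonormal (Hilbert) basis of `H`. -/
def onbIndex (H : Type*) [NormedAddCommGroup H] [InnerProductSpace ℂ H] [CompleteSpace H] :
    Set H :=
  (exists_hilbertBasis ℂ H).choose

/-- A fixed orthonormal (Hilbert) basis of `H`. The trace norm and the trace of a trace class
operator do not depend on this choice. -/
def onb (H : Type*) [NormedAddCommGroup H] [InnerProductSpace ℂ H] [CompleteSpace H] :
    HilbertBasis (onbIndex H) ℂ H :=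
  (exists_hilbertBasis ℂ H).choose_spec.choose

/-- The trace norm `‖x‖₁ = Tr |x| = ∑ᵢ ⟨eᵢ, |x| eᵢ⟩ ∈ [0, ∞]`, where `|x| = (x* x)^{1/2}`. -/
def eTraceNorm (x : H →L[ℂ] H) : ENNReal :=
  ∑' i, ENNReal.ofReal (inner ℂ (onb H i) (CFC.abs x (onb H i))).re

/-- Trace class operators: `Tr |x| < ∞`. -/
def IsTraceClass (x : H →L[ℂ] H) : Prop := eTraceNorm x < ⊤

/-- The trace norm as a real number (meaningful for trace class operators). -/
def traceNorm (x : H →L[ℂ] H) : ℝ := (eTraceNorm x).toReal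

/-- The trace `Tr x = ∑ᵢ ⟨eᵢ, x eᵢ⟩` (an absolutely convergent sum when `x` is trace class).
Mathlib's inner product is linear in the second variable. -/
def trace (x : H →L[ℂ] H) : ℂ := ∑' i, inner ℂ (onb H i) (x (onb H i))

/-- The trace norm distance `dist₁(x, V) = inf {‖x - v‖₁ : v ∈ V}`. -/
def traceDist (x : H →L[ℂ] H) (V : Submodule ℂ (H →L[ℂ] H)) : ℝ :=
  ⨅ v : V, traceNorm (x - (v : H →L[ℂ] H))

/-- `N_V = {a ∈ B(H) : Tr (a y) = 0 for all y ∈ V}`. -/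
def traceAnnihilator (V : Submodule ℂ (H →L[ℂ] H)) : Set (H →L[ℂ] H) :=
  {a | ∀ y ∈ V, trace (a * y) = 0}

/-- `u` is an isometry (`u* u = 1`) or a co-isometry (`u u* = 1`). -/
def IsIsometryOrCoisometry (u : H →L[ℂ] H) : Prop :=
  star u * u = 1 ∨ u * star u = 1

end TraceDist

end

/-! If `a` annihilates `V`, then Tr(ax) = Tr(a(x - v)) for every v in `V`, so |Tr(ax)| ≤ ‖a‖ dist.
The reverse direction is finite-dimensional: the map L : a ↦ ((Tr(a vⱼ))ⱼ, Re Tr(ax)) takes values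
in ℂⁿ × ℝ, of real dimension 2n + 1. A nonzero functional on this space pairs `a` with some y = v +
βx ≠ 0. If (0, t), with 0 ≤ t < dist, were missing from the image of the compact contractions,
separation would give Re Tr(ay) ≤ βt on all of them. Since compact contractions compute the trace
norm (`isTraceClass_and_traceNorm_le`), ‖y‖₁ ≤ βt, against ‖y‖₁ ≥ |β| dist. The endpoint t = dist is
attained because the unit ball is compact in the weak operator topology and L is continuous on it.

The point (0, dist) is not in the image of the open ball, so a hyperplane supports the image of the
closed ball there. Carathéodory's theorem inside that hyperplane writes the point with at most 2n +
1 images of extreme points (`exists_sum_extremePoints_of_supporting`), and extreme contractions are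
isometries or co-isometries. With the weights fixed, any admissible tuple averages to a contraction
annihilating `V`, so it cannot exceed dist. -/

namespace TraceDist

/-! ### Separation, extreme points and Carathéodory in finite dimension -/

section Convexity

variable {E : Type*} [NormedAddCommGroup E] [NormedSpace ℝ E] [FiniteDimensional ℝ E]

/-- Weak separation of a point from a convex set in a finite-dimensional space. -/
theorem exists_ne_zero_forall_le_of_notMem {s : Set E} (hs : Convex ℝ s) (hne : s.Nonempty)
    {p : E} (hp : p ∉ s) : ∃ f : E →ₗ[ℝ] ℝ, f ≠ 0 ∧ ∀ q ∈ s, f q ≤ f p := by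
  by_cases hi : (interior s).Nonempty
  · obtain ⟨f, hf0, hf⟩ := geometric_hahn_banach_of_nonempty_interior_point hs
      (fun h => hp (interior_subset h)) hi
    refine ⟨f, fun h => hf0 ?_, hf⟩
    ext v
    exact LinearMap.congr_fun h v
  -- Without interior, `s` lies in a proper affine subspace; a functional killing its direction is
  -- constant on `s`, and its sign can be chosen to suit `p`.
  · rw [hs.interior_nonempty_iff_affineSpan_eq_top] at hi
    have hD : vectorSpan ℝ s < ⊤ := by
      refine lt_top_iff_ne_top.2 fun h => hi ?_
      rwa [AffineSubspace.affineSpan_eq_top_iff_vectorSpan_eq_top_of_nonempty ℝ E E hne]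
    obtain ⟨f, hf0, hf⟩ := Submodule.exists_le_ker_of_lt_top _ hD
    obtain ⟨q₀, hq₀⟩ := hne
    have hconst : ∀ q ∈ s, f q = f q₀ := fun q hq => by
      have := hf (vsub_mem_vectorSpan ℝ hq hq₀)
      rw [LinearMap.mem_ker, vsub_eq_sub, map_sub] at this
      linarith
    rcases le_total (f q₀) (f p) with h | h
    · exact ⟨f, hf0, fun q hq => (hconst q hq).trans_le h⟩
    · refine ⟨-f, neg_ne_zero.2 hf0, fun q hq => ?_⟩
      simpa [hconst q hq] using h

theorem isCompact_sep_eq {X : Type*} [TopologicalSpace X] [T2Space X] {S : Set X}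
    (hS : IsCompact S) {g : X → ℝ} (hg : ContinuousOn g S)
    (c : ℝ) : IsCompact {s ∈ S | g s = c} := by
  have := isCompact_iff_compactSpace.1 hS
  have h : IsClosed {s : S | g s = c} :=
    isClosed_eq (continuousOn_iff_continuous_domRestrict.1 hg) continuous_const
  have := h.isCompact.image continuous_subtype_val
  convert this using 1
  ext s
  simp [and_comm]

theorem isExtreme_sep_eq {X : Type*} [AddCommGroup X] [Module ℝ X] {S : Set X}
    {g : X →ₗ[ℝ] ℝ} {c : ℝ} (hc : ∀ s ∈ S, g s ≤ c) :
    IsExtreme ℝ S {s ∈ S | g s = c} := by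
  refine ⟨fun s hs => hs.1, ?_⟩
  rintro s hs t ht z ⟨-, hz⟩ ⟨a, b, ha, hb, hab, rfl⟩
  refine ⟨hs, le_antisymm (hc s hs) ?_⟩
  rw [map_add, map_smul, map_smul, smul_eq_mul, smul_eq_mul] at hz
  have h1 := hc t ht
  have h2 : b * g t ≤ b * c := by gcongr
  have h3 : a * c ≤ a * g s := by
    have : a * c + b * c = c := by rw [← add_mul, hab, one_mul]
    linarith
  exact le_of_mul_le_mul_left h3 ha

theorem convex_sep_eq {X : Type*} [AddCommGroup X] [Module ℝ X]
    {S : Set X} (hS : Convex ℝ S) (g : X →ₗ[ℝ] ℝ) (c : ℝ) :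
    Convex ℝ {s ∈ S | g s = c} :=
  hS.inter (convex_hyperplane g.isLinear c)

variable {X : Type*} [AddCommGroup X] [Module ℝ X] [TopologicalSpace X] [T2Space X]
  [IsTopologicalAddGroup X] [ContinuousSMul ℝ X] [LocallyConvexSpace ℝ X]

/-- Bauer's maximum principle, for a linear functional that is continuous on the compact set. -/
theorem forall_le_of_forall_extremePoints_le {S : Set X} (hS : IsCompact S)
    {g : X →ₗ[ℝ] ℝ} (hg : ContinuousOn g S) {c : ℝ} (hc : ∀ s ∈ S.extremePoints ℝ, g s ≤ c) :
    ∀ s ∈ S, g s ≤ c := by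
  intro s hs
  obtain ⟨s₁, hs₁, hmax⟩ := hS.exists_isMaxOn ⟨s, hs⟩ hg
  obtain ⟨z, hz⟩ := (isCompact_sep_eq hS hg (g s₁)).extremePoints_nonempty ⟨s₁, hs₁, rfl⟩
  have hz' := (isExtreme_sep_eq (fun t ht => hmax ht)).extremePoints_subset_extremePoints hz
  calc g s ≤ g s₁ := hmax hs
    _ = g z := hz.1.2.symm
    _ ≤ c := hc z hz'

/-- A finite-dimensional Krein–Milman theorem without closure: the image of a compact convex set
under a linear map to a finite-dimensional space is the convex hull of the image of its extreme
points. -/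
theorem image_subset_convexHull_image_extremePoints {S : Set X} (hS : IsCompact S)
    (hc : Convex ℝ S) (L : X →ₗ[ℝ] E) (hL : ContinuousOn L S) :
    L '' S ⊆ convexHull ℝ (L '' S.extremePoints ℝ) := by
  induction hm : Module.finrank ℝ E using Nat.strong_induction_on generalizing E S with
  | _ m ih =>
  rintro _ ⟨s₀, hs₀, rfl⟩
  by_contra hp
  obtain ⟨f, hf0, hf⟩ := exists_ne_zero_forall_le_of_notMem (convex_convexHull ℝ _)
    (((hS.extremePoints_nonempty ⟨s₀, hs₀⟩).image L).mono (subset_convexHull ℝ _)) hp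
  have hfc : Continuous f := f.continuous_of_finiteDimensional
  have hg : ContinuousOn (f ∘ₗ L) S := hfc.comp_continuousOn hL
  have hle : ∀ s ∈ S, (f ∘ₗ L) s ≤ f (L s₀) := forall_le_of_forall_extremePoints_le hS hg
    fun s hs => hf _ (subset_convexHull ℝ _ ⟨s, hs, rfl⟩)
  set F : Set X := {s ∈ S | (f ∘ₗ L) s = f (L s₀)} with hF
  have hFS : F ⊆ S := fun s hs => hs.1
  -- On the face `F` the value of `f ∘ L` is constant, so projecting to `ker f` loses nothing and
  -- lowers the dimension for the induction.
  obtain ⟨π, hπ⟩ := (LinearMap.ker f).subtype.exists_leftInverse_of_injective (by simp)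
  have hπ' : ∀ z, f z = 0 → π z = 0 → z = 0 := fun z hz h => by
    have := LinearMap.congr_fun hπ ⟨z, hz⟩
    simp only [LinearMap.comp_apply, Submodule.subtype_apply, h, LinearMap.id_apply] at this
    exact (congrArg Subtype.val this).symm
  have hlt : Module.finrank ℝ (LinearMap.ker f) < m := by
    rw [← hm]
    exact Submodule.finrank_lt fun h => hf0 (LinearMap.ker_eq_top.1 h)
  have hπL : ContinuousOn (π ∘ₗ L) F :=
    (π.continuous_of_finiteDimensional.comp_continuousOn hL).mono hFS
  have key := ih _ hlt (isCompact_sep_eq hS hg _) (convex_sep_eq hc _ _) (π ∘ₗ L) hπL rfl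
    ⟨s₀, ⟨hs₀, rfl⟩, rfl⟩
  rw [LinearMap.coe_comp, Set.image_comp, ← LinearMap.image_convexHull] at key
  obtain ⟨z, hz, hzp⟩ := key
  have hfz : f z = f (L s₀) := by
    have : convexHull ℝ (L '' F.extremePoints ℝ) ⊆ {w | f w = f (L s₀)} := by
      refine convexHull_min ?_ (convex_hyperplane f.isLinear _)
      rintro _ ⟨s, hs, rfl⟩
      exact hs.1.2
    exact this hz
  have hzeq : z = L s₀ := sub_eq_zero.1 (hπ' _ (by rw [map_sub, hfz, sub_self])
    (by rw [map_sub, hzp]; simp))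
  rw [hzeq] at hz
  exact hp (convexHull_mono (Set.image_mono
    (isExtreme_sep_eq hle).extremePoints_subset_extremePoints) hz)

/-- Carathéodory's theorem for a boundary point of the image of a compact convex set. -/
theorem exists_sum_extremePoints_of_supporting {S : Set X} (hS : IsCompact S)
    (hc : Convex ℝ S) (L : X →ₗ[ℝ] E) (hL : ContinuousOn L S) {s₀ : X} (hs₀ : s₀ ∈ S)
    {f : E →ₗ[ℝ] ℝ} (hf0 : f ≠ 0) (hf : ∀ s ∈ S, f (L s) ≤ f (L s₀)) :
    ∃ (k : ℕ) (w : Fin k → ℝ) (u : Fin k → X), k ≤ Module.finrank ℝ E ∧ (∀ i, 0 < w i) ∧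
      ∑ i, w i = 1 ∧ (∀ i, u i ∈ S.extremePoints ℝ) ∧ ∑ i, w i • L (u i) = L s₀ := by
  obtain ⟨ι, _, z, w, hz, hind, hw, hw1, hsum⟩ := eq_pos_convex_span_of_mem_convexHull
    (image_subset_convexHull_image_extremePoints hS hc L hL ⟨s₀, hs₀, rfl⟩)
  have hz' : ∀ i, ∃ s ∈ S.extremePoints ℝ, L s = z i := fun i => hz ⟨i, rfl⟩
  choose u hu huz using hz'
  -- A weighted mean with positive weights equals its upper bound only if every term does.
  have hfi : ∀ i, f (z i) = f (L s₀) := by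
    have hle : ∀ i ∈ Finset.univ, w i * f (z i) ≤ w i * f (L s₀) := fun i _ =>
      mul_le_mul_of_nonneg_left (huz i ▸ hf _ (hu i).1) (hw i).le
    have heq : ∑ i, w i * f (z i) = ∑ i, w i * f (L s₀) := by
      rw [← Finset.sum_mul, hw1, one_mul, ← hsum, map_sum]
      simp
    intro i
    exact mul_left_cancel₀ (hw i).ne' ((Finset.sum_eq_sum_iff_of_le hle).1 heq i (Finset.mem_univ i))
  have hspan : vectorSpan ℝ (Set.range z) ≤ LinearMap.ker f := by
    rw [vectorSpan_def, Submodule.span_le]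
    rintro _ ⟨_, ⟨i, rfl⟩, _, ⟨j, rfl⟩, rfl⟩
    simp [hfi]
  -- Affinely independent points in a translate of `ker f` number at most dim `ker f` + 1; this
  -- saves one over plain Carathéodory.
  have hcard : Fintype.card ι ≤ Module.finrank ℝ E := by
    have h1 := hind.card_le_finrank_succ
    have h2 := Submodule.finrank_mono hspan
    have h3 : Module.finrank ℝ (LinearMap.ker f) < Module.finrank ℝ E :=
      Submodule.finrank_lt fun h => hf0 (LinearMap.ker_eq_top.1 h)
    omega
  let e := (Fintype.equivFin ι).symm
  refine ⟨Fintype.card ι, w ∘ e, u ∘ e, hcard, fun i => hw _, ?_, fun i => hu _, ?_⟩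
  · rw [← hw1]
    exact e.sum_comp w
  · rw [← hsum]
    simp only [Function.comp_apply, huz]
    exact e.sum_comp fun i => w i • z i

end Convexity

end TraceDist

namespace TraceDist

/-! ### Trace class operators and trace norm duality -/

section TraceClass

open scoped ENNReal InnerProductSpace

variable {H : Type*} [NormedAddCommGroup H] [InnerProductSpace ℂ H]

theorem enorm_inner_comm (v w : H) : ‖⟪v, w⟫_ℂ‖ₑ = ‖⟪w, v⟫_ℂ‖ₑ := by
  rw [← ofReal_norm, ← ofReal_norm, norm_inner_symm]

theorem norm_inner_apply_le {a : H →L[ℂ] H} {r : ℝ} (ha : ‖a‖ ≤ r) (v w : H) :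
    ‖⟪v, a w⟫_ℂ‖ ≤ r * (‖v‖ * ‖w‖) := by
  calc _ ≤ ‖v‖ * ‖a w‖ := norm_inner_le_norm _ _
    _ ≤ ‖v‖ * (r * ‖w‖) := by
      gcongr
      exact a.le_of_opNorm_le ha w
    _ = _ := by ring

theorem hasSum_norm_inner_sq {ι : Type*} (b : HilbertBasis ι ℂ H) (v : H) :
    HasSum (fun i => ‖⟪b i, v⟫_ℂ‖ ^ 2) (‖v‖ ^ 2) := by
  have h : HasSum (fun i => ⟪v, b i⟫_ℂ * ⟪b i, v⟫_ℂ) ((‖v‖ ^ 2 : ℝ) : ℂ) := by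
    have := b.hasSum_inner_mul_inner v v
    rw [inner_self_eq_norm_sq_to_K] at this
    push_cast
    exact this
  have h2 : ∀ i, ⟪v, b i⟫_ℂ * ⟪b i, v⟫_ℂ = ((‖⟪b i, v⟫_ℂ‖ ^ 2 : ℝ) : ℂ) := fun i => by
    rw [← inner_conj_symm v, Complex.conj_mul']
    simp
  simp_rw [h2] at h
  exact Complex.hasSum_ofReal.1 h

theorem tsum_enorm_inner_sq {ι : Type*} (b : HilbertBasis ι ℂ H) (v : H) :
    ∑' i, ‖⟪b i, v⟫_ℂ‖ₑ ^ 2 = ‖v‖ₑ ^ 2 := by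
  have h := hasSum_norm_inner_sq b v
  have e : ∀ z : ℝ, 0 ≤ z → ENNReal.ofReal (z ^ 2) = ENNReal.ofReal z ^ 2 := fun z hz =>
    ENNReal.ofReal_pow hz 2
  rw [← ofReal_norm, ← e _ (norm_nonneg _), ← h.tsum_eq,
    ENNReal.ofReal_tsum_of_nonneg (fun _ => by positivity) h.summable]
  simp_rw [e _ (norm_nonneg _), ofReal_norm]

variable [CompleteSpace H]

/-- Douglas' factorization lemma. -/
theorem exists_mul_eq_of_norm_apply_le (A B : H →L[ℂ] H) (h : ∀ v, ‖A v‖ ≤ ‖B v‖) :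
    ∃ w : H →L[ℂ] H, ‖w‖ ≤ 1 ∧ A = w * B := by
  let K : Submodule ℂ H := (LinearMap.range B.toLinearMap).topologicalClosure
  have : CompleteSpace K :=
    (LinearMap.range B.toLinearMap).isClosed_topologicalClosure.completeSpace_coe
  let e : H →ₗ[ℂ] K := B.toLinearMap.codRestrict K fun v =>
    Submodule.le_topologicalClosure _ (LinearMap.mem_range_self _ v)
  have hd : DenseRange e := by
    rw [DenseRange, Subtype.dense_iff]
    intro v hv
    have : (Subtype.val '' Set.range e : Set H) = LinearMap.range B.toLinearMap := by
      ext v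
      simp [e, K]
    exact this ▸ hv
  have hn : ∀ v, ‖A.toLinearMap v‖ ≤ 1 * ‖e v‖ := fun v => by
    rw [one_mul]
    exact h v
  -- The map Bv ↦ Av extends to the closure of the range of `B`; the projection sets it to zero on
  -- the complement.
  refine ⟨(A.toLinearMap.extendOfNorm e).comp K.orthogonalProjectionOnto, ?_, ?_⟩
  · calc _ ≤ _ := ContinuousLinearMap.opNorm_comp_le _ _
      _ ≤ 1 * 1 := by
        gcongr
        · exact LinearMap.opNorm_extendOfNorm_le hd zero_le_one hn
        · exact K.orthogonalProjectionOnto_norm_le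
      _ = 1 := one_mul 1
  · ext v
    have h1 : K.orthogonalProjectionOnto (B v) = e v :=
      K.orthogonalProjectionOnto_mem_subspace_eq_self (e v)
    have h2 := LinearMap.extendOfNorm_eq hd ⟨1, hn⟩ v
    simp only [mul_apply_eq_comp, ContinuousLinearMap.comp_apply, h1, h2]
    rfl

/-- The square of the Hilbert–Schmidt norm. -/
noncomputable def hsNormSq (b : H →L[ℂ] H) : ℝ≥0∞ := ∑' i, ‖b (onb H i)‖ₑ ^ 2

theorem tsum_tsum_enorm_inner_sq (b : H →L[ℂ] H) :
    ∑' i, ∑' j, ‖⟪onb H j, b (onb H i)⟫_ℂ‖ₑ ^ 2 = hsNormSq b := by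
  simp_rw [tsum_enorm_inner_sq, hsNormSq]

/-- Both sides sum the squared moduli of all matrix entries, and the adjoint only transposes them.
-/
theorem hsNormSq_star (b : H →L[ℂ] H) : hsNormSq (star b) = hsNormSq b := by
  rw [← tsum_tsum_enorm_inner_sq, ENNReal.tsum_comm, ← tsum_tsum_enorm_inner_sq]
  simp_rw [ContinuousLinearMap.star_eq_adjoint, ContinuousLinearMap.adjoint_inner_right,
    enorm_inner_comm (b _)]

theorem hsNormSq_mul_le (a b : H →L[ℂ] H) : hsNormSq (a * b) ≤ ‖a‖ₑ ^ 2 * hsNormSq b := by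
  rw [hsNormSq, hsNormSq, ← ENNReal.tsum_mul_left]
  refine ENNReal.tsum_le_tsum fun i => ?_
  rw [← mul_pow]
  gcongr
  exact a.le_opENorm _

theorem hsNormSq_mul_lt_top (a : H →L[ℂ] H) {b : H →L[ℂ] H} (hb : hsNormSq b < ∞) :
    hsNormSq (a * b) < ∞ :=
  (hsNormSq_mul_le a b).trans_lt (ENNReal.mul_lt_top (by simp) hb)

theorem summable_norm_sq_of_tsum_lt_top {ι E : Type*} [NormedAddCommGroup E] {f : ι → E}
    (h : ∑' i, ‖f i‖ₑ ^ 2 < ∞) : Summable fun i => ‖f i‖ ^ 2 := by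
  have := ENNReal.summable_toReal h.ne
  simpa using this

theorem summable_mul_of_sq {ι : Type*} {f g : ι → ℝ} (hf : Summable fun i => f i ^ 2)
    (hg : Summable fun i => g i ^ 2) : Summable fun i => f i * g i := by
  refine Summable.of_norm_bounded (hf.add hg) fun i => ?_
  rw [Real.norm_eq_abs, abs_mul]
  nlinarith [sq_nonneg (|f i| - |g i|), sq_abs (f i), sq_abs (g i), sq_nonneg (f i),
    sq_nonneg (g i)]

theorem inner_mul_apply (b c : H →L[ℂ] H) (v w : H) :
    ⟪v, (b * c) w⟫_ℂ = ⟪star b v, c w⟫_ℂ := by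
  rw [ContinuousLinearMap.star_eq_adjoint, ContinuousLinearMap.adjoint_inner_left]
  rfl

theorem summable_inner_mul {b c : H →L[ℂ] H} (hb : hsNormSq b < ∞) (hc : hsNormSq c < ∞) :
    Summable fun i => ⟪onb H i, (b * c) (onb H i)⟫_ℂ := by
  rw [← hsNormSq_star] at hb
  refine Summable.of_norm_bounded (summable_mul_of_sq (summable_norm_sq_of_tsum_lt_top hb)
    (summable_norm_sq_of_tsum_lt_top hc)) fun i => ?_
  rw [inner_mul_apply]
  exact norm_inner_le_norm _ _

theorem summable_prod_inner_sq {b : H →L[ℂ] H} (hb : hsNormSq b < ∞) :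
    Summable fun p : onbIndex H × onbIndex H => ‖⟪onb H p.2, b (onb H p.1)⟫_ℂ‖ ^ 2 := by
  refine summable_norm_sq_of_tsum_lt_top ?_
  rw [ENNReal.tsum_prod (f := fun i j => ‖⟪onb H j, b (onb H i)⟫_ℂ‖ₑ ^ 2)]
  rwa [tsum_tsum_enorm_inner_sq]

/-- Cyclicity of the trace for Hilbert–Schmidt operators. -/
theorem trace_mul_comm_of_hs {b c : H →L[ℂ] H} (hb : hsNormSq b < ∞) (hc : hsNormSq c < ∞) :
    trace (b * c) = trace (c * b) := by
  have hexp : ∀ (b c : H →L[ℂ] H) i, ∑' j, ⟪onb H i, b (onb H j)⟫_ℂ * ⟪onb H j, c (onb H i)⟫_ℂ =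
      ⟪onb H i, (b * c) (onb H i)⟫_ℂ := fun b c i => by
    rw [inner_mul_apply, ← (onb H).tsum_inner_mul_inner]
    simp_rw [ContinuousLinearMap.star_eq_adjoint, ContinuousLinearMap.adjoint_inner_left]
  have hsum : Summable (Function.uncurry fun i j =>
      ⟪onb H i, b (onb H j)⟫_ℂ * ⟪onb H j, c (onb H i)⟫_ℂ) := by
    refine Summable.of_norm_bounded (summable_mul_of_sq
      ((Equiv.prodComm _ _).summable_iff.2 (summable_prod_inner_sq hb))
      (summable_prod_inner_sq hc)) fun p => ?_
    simp [Function.uncurry]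
  rw [trace, trace]
  simp_rw [← hexp]
  rw [← hsum.tsum_comm]
  simp_rw [mul_comm]

theorem norm_eq_of_star_mul_eq {a b : H →L[ℂ] H} (h : star a * a = star b * b) (v : H) :
    ‖a v‖ = ‖b v‖ := by
  have h1 : ⟪a v, a v⟫_ℂ = ⟪b v, b v⟫_ℂ := by
    have := congrArg (fun m : H →L[ℂ] H => ⟪v, m v⟫_ℂ) h
    simpa only [inner_mul_apply, star_star] using this
  rw [inner_self_eq_norm_sq_to_K, inner_self_eq_norm_sq_to_K] at h1
  have h2 : ‖a v‖ ^ 2 = ‖b v‖ ^ 2 := by exact_mod_cast h1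
  exact (pow_left_inj₀ (norm_nonneg _) (norm_nonneg _) two_ne_zero).1 h2

theorem star_abs (x : H →L[ℂ] H) : star (CFC.abs x) = CFC.abs x :=
  (IsSelfAdjoint.of_nonneg (CFC.abs_nonneg x)).star_eq

/-- The polar decomposition, in a weak form. -/
theorem exists_eq_mul_abs (x : H →L[ℂ] H) :
    ∃ w : H →L[ℂ] H, ‖w‖ ≤ 1 ∧ x = w * CFC.abs x :=
  exists_mul_eq_of_norm_apply_le _ _ fun v => (norm_eq_of_star_mul_eq
    (by rw [star_abs, CFC.abs_mul_abs]) v).le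

theorem exists_abs_eq_mul (x : H →L[ℂ] H) :
    ∃ w : H →L[ℂ] H, ‖w‖ ≤ 1 ∧ CFC.abs x = w * x :=
  exists_mul_eq_of_norm_apply_le _ _ fun v => (norm_eq_of_star_mul_eq
    (by rw [star_abs, CFC.abs_mul_abs]) v).le

/-- Every operator factors through the square root of its modulus, whose Hilbert–Schmidt norm is
determined by the trace norm. -/
theorem exists_eq_mul_sqrt_mul_sqrt (x : H →L[ℂ] H) :
    ∃ w c : H →L[ℂ] H, ‖w‖ ≤ 1 ∧ star c = c ∧ x = w * c * c ∧ hsNormSq c = eTraceNorm x := by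
  obtain ⟨w, hw, hx⟩ := exists_eq_mul_abs x
  have hc : CFC.sqrt (CFC.abs x) * CFC.sqrt (CFC.abs x) = CFC.abs x :=
    CFC.sqrt_mul_sqrt_self _ (CFC.abs_nonneg x)
  have hs : star (CFC.sqrt (CFC.abs x)) = CFC.sqrt (CFC.abs x) :=
    (IsSelfAdjoint.of_nonneg (CFC.sqrt_nonneg _)).star_eq
  refine ⟨w, CFC.sqrt (CFC.abs x), hw, hs, by rw [mul_assoc, hc, ← hx], ?_⟩
  rw [hsNormSq, eTraceNorm]
  refine tsum_congr fun i => ?_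
  nth_rewrite 2 [← hc]
  rw [inner_mul_apply, hs, inner_self_eq_norm_sq_to_K, ← ofReal_norm,
    ← ENNReal.ofReal_pow (norm_nonneg _)]
  congr 1
  norm_cast

theorem IsTraceClass.summable {x : H →L[ℂ] H} (hx : IsTraceClass x) (a : H →L[ℂ] H) :
    Summable fun i => ⟪onb H i, (a * x) (onb H i)⟫_ℂ := by
  obtain ⟨w, c, -, -, h, hc⟩ := exists_eq_mul_sqrt_mul_sqrt x
  have hc' : hsNormSq c < ∞ := hc ▸ hx
  rw [h, ← mul_assoc]
  exact summable_inner_mul (hsNormSq_mul_lt_top _ (hsNormSq_mul_lt_top _ hc')) hc'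

/-- The functional `a ↦ Tr (a x)` is an absolutely convergent sum of vector functionals. -/
theorem IsTraceClass.exists_trace_mul_eq {x : H →L[ℂ] H} (hx : IsTraceClass x) :
    ∃ f g : onbIndex H → H, Summable (fun i => ‖f i‖ * ‖g i‖) ∧
      ∑' i, ‖f i‖ * ‖g i‖ ≤ traceNorm x ∧
      ∀ a : H →L[ℂ] H, trace (a * x) = ∑' i, ⟪f i, a (g i)⟫_ℂ := by
  obtain ⟨w, c, hw, hs, h, hc⟩ := exists_eq_mul_sqrt_mul_sqrt x
  have hc' : hsNormSq c < ∞ := hc ▸ hx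
  have hsum : Summable fun i => ‖c (onb H i)‖ ^ 2 := summable_norm_sq_of_tsum_lt_top hc'
  have hle : ∀ i, ‖c (onb H i)‖ * ‖w (c (onb H i))‖ ≤ ‖c (onb H i)‖ ^ 2 := fun i => by
    rw [sq]
    gcongr
    simpa using w.le_of_opNorm_le hw (c (onb H i))
  have hsum' := Summable.of_nonneg_of_le (fun i => by positivity) hle hsum
  refine ⟨fun i => c (onb H i), fun i => w (c (onb H i)), hsum', ?_, fun a => ?_⟩
  · refine (hsum'.tsum_le_tsum hle hsum).trans_eq ?_
    rw [traceNorm, ← hc, hsNormSq, ENNReal.tsum_toReal_eq (fun i => by simp)]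
    simp
  -- Cyclicity moves one factor `c` to the left of `a`, giving the terms ⟨c eᵢ, a w c eᵢ⟩.
  · rw [h, ← mul_assoc, trace_mul_comm_of_hs
      (hsNormSq_mul_lt_top _ (hsNormSq_mul_lt_top _ hc')) hc', trace]
    refine tsum_congr fun i => ?_
    rw [inner_mul_apply, hs]
    rfl

theorem traceNorm_nonneg (x : H →L[ℂ] H) : 0 ≤ traceNorm x := ENNReal.toReal_nonneg

theorem IsTraceClass.norm_trace_mul_le {x : H →L[ℂ] H} (hx : IsTraceClass x) (a : H →L[ℂ] H) :
    ‖trace (a * x)‖ ≤ ‖a‖ * traceNorm x := by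
  obtain ⟨f, g, hs, hle, htr⟩ := hx.exists_trace_mul_eq
  rw [htr]
  calc _ ≤ ∑' i, ‖a‖ * (‖f i‖ * ‖g i‖) :=
        tsum_of_norm_bounded (hs.mul_left _).hasSum fun i => norm_inner_apply_le le_rfl _ _
    _ ≤ _ := by
      rw [tsum_mul_left]
      gcongr

theorem IsTraceClass.trace_add_mul {x : H →L[ℂ] H} (hx : IsTraceClass x) (a b : H →L[ℂ] H) :
    trace ((a + b) * x) = trace (a * x) + trace (b * x) := by
  simp only [trace]
  rw [← (hx.summable a).tsum_add (hx.summable b)]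
  simp [add_mul]

theorem trace_smul (a : H →L[ℂ] H) (z : ℂ) : trace (z • a) = z * trace a := by
  simp only [trace]
  rw [← tsum_mul_left]
  simp

theorem trace_mul_add {x y : H →L[ℂ] H} (hx : IsTraceClass x) (hy : IsTraceClass y)
    (a : H →L[ℂ] H) : trace (a * (x + y)) = trace (a * x) + trace (a * y) := by
  simp only [trace]
  rw [← (hx.summable a).tsum_add (hy.summable a)]
  simp [mul_add]

/-- The trace norm is determined by pairing with compact contractions. -/
theorem isTraceClass_and_traceNorm_le {x : H →L[ℂ] H} {C : ℝ}
    (hC : ∀ a : H →L[ℂ] H, IsCompactOperator a → ‖a‖ ≤ 1 → (trace (a * x)).re ≤ C) :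
    IsTraceClass x ∧ traceNorm x ≤ C := by
  have hC0 : 0 ≤ C := by
    simpa [trace] using hC 0 isCompactOperator_zero (by simp)
  suffices h : eTraceNorm x ≤ ENNReal.ofReal C from
    ⟨h.trans_lt ENNReal.ofReal_lt_top, ENNReal.toReal_le_of_le_ofReal hC0 h⟩
  obtain ⟨w, hw, hwx⟩ := exists_abs_eq_mul x
  rw [eTraceNorm, ENNReal.tsum_eq_iSup_sum]
  refine iSup_le fun F => ?_
  have hpos : ∀ i, 0 ≤ (⟪onb H i, CFC.abs x (onb H i)⟫_ℂ).re := fun i =>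
    (((CFC.abs x).nonneg_iff_isPositive).1 (CFC.abs_nonneg x)).re_inner_nonneg_right _
  rw [← ENNReal.ofReal_sum_of_nonneg fun i _ => hpos i]
  refine ENNReal.ofReal_le_ofReal ?_
  -- With P the projection onto `K`, the finite-rank contraction P w pairs with `x` to give exactly
  -- the partial sum of Tr |x| over `F`.
  let K : Submodule ℂ H := Submodule.span ℂ (onb H '' F)
  have hfin : FiniteDimensional ℂ K :=
    FiniteDimensional.span_of_finite ℂ (F.finite_toSet.image _)
  have hmem : ∀ i ∈ F, K.starProjection (onb H i) = onb H i := fun i hi =>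
    Submodule.starProjection_eq_self_iff.2 (Submodule.subset_span ⟨i, hi, rfl⟩)
  have hnot : ∀ i ∉ F, K.starProjection (onb H i) = 0 := fun i hi => by
    rw [Submodule.starProjection_apply_eq_zero_iff, Submodule.mem_orthogonal]
    intro u hu
    induction hu using Submodule.span_induction with
    | mem u hu =>
      obtain ⟨j, hj, rfl⟩ := hu
      exact (onb H).orthonormal.2 fun h => hi (h ▸ hj)
    | zero => simp
    | add u v _ _ hu hv => simp [inner_add_left, hu, hv]
    | smul z u _ hu => simp [inner_smul_left, hu]
  have hcomp : IsCompactOperator (K.starProjection * w) := by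
    have : IsCompactOperator (K.orthogonalProjectionOnto) :=
      isCompactOperator_of_locallyCompactSpace_dom _
    exact (this.clm_comp K.subtypeL).comp_clm w
  have hnorm : ‖K.starProjection * w‖ ≤ 1 :=
    (norm_mul_le _ _).trans (mul_le_one₀ K.starProjection_norm_le (norm_nonneg _) hw)
  have hstar : star K.starProjection = K.starProjection := isSelfAdjoint_starProjection K
  have htr : trace (K.starProjection * w * x) = ∑ i ∈ F, ⟪onb H i, CFC.abs x (onb H i)⟫_ℂ := by
    rw [mul_assoc, ← hwx, trace, tsum_eq_sum (s := F)]
    · refine Finset.sum_congr rfl fun i hi => ?_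
      rw [inner_mul_apply, hstar, hmem i hi]
    · intro i hi
      rw [inner_mul_apply, hstar, hnot i hi, inner_zero_left]
  have := hC _ hcomp hnorm
  rwa [htr, Complex.re_sum] at this

theorem IsTraceClass.re_trace_mul_le {x : H →L[ℂ] H} (hx : IsTraceClass x) {a : H →L[ℂ] H}
    (ha : ‖a‖ ≤ 1) : (trace (a * x)).re ≤ traceNorm x :=
  calc _ ≤ ‖trace (a * x)‖ := Complex.re_le_norm _
    _ ≤ ‖a‖ * traceNorm x := hx.norm_trace_mul_le a
    _ ≤ traceNorm x := mul_le_of_le_one_left (traceNorm_nonneg x) ha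

/-- Duality replaces the nonlinear modulus |x + y| by pairings, which are additive. -/
theorem IsTraceClass.add {x y : H →L[ℂ] H} (hx : IsTraceClass x) (hy : IsTraceClass y) :
    IsTraceClass (x + y) :=
  (isTraceClass_and_traceNorm_le (C := traceNorm x + traceNorm y) fun a _ ha => by
    rw [trace_mul_add hx hy, Complex.add_re]
    exact add_le_add (hx.re_trace_mul_le ha) (hy.re_trace_mul_le ha)).1

theorem IsTraceClass.smul_and_traceNorm_le {x : H →L[ℂ] H} (hx : IsTraceClass x) (z : ℂ) :
    IsTraceClass (z • x) ∧ traceNorm (z • x) ≤ ‖z‖ * traceNorm x :=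
  isTraceClass_and_traceNorm_le fun a _ ha => by
    rw [mul_smul_comm, trace_smul]
    calc _ ≤ _ := Complex.re_le_norm _
      _ = ‖z‖ * ‖trace (a * x)‖ := norm_mul _ _
      _ ≤ ‖z‖ * traceNorm x := by
        gcongr
        exact (hx.norm_trace_mul_le a).trans (mul_le_of_le_one_left (traceNorm_nonneg x) ha)

theorem IsTraceClass.smul {x : H →L[ℂ] H} (hx : IsTraceClass x) (z : ℂ) : IsTraceClass (z • x) :=
  (hx.smul_and_traceNorm_le z).1

theorem isTraceClass_zero : IsTraceClass (0 : H →L[ℂ] H) :=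
  (isTraceClass_and_traceNorm_le (C := 0) fun a _ _ => by simp [trace]).1

theorem IsTraceClass.eq_zero_of_traceNorm_le {x : H →L[ℂ] H} (hx : IsTraceClass x)
    (h0 : traceNorm x ≤ 0) : x = 0 := by
  obtain ⟨w, c, -, hs, h, hc⟩ := exists_eq_mul_sqrt_mul_sqrt x
  have h1 : hsNormSq c = 0 := by
    rw [hc]
    exact ((ENNReal.toReal_eq_zero_iff _).1 (h0.antisymm (traceNorm_nonneg x))).resolve_right
      (ne_of_lt hx)
  have h2 : ∀ i, c (onb H i) = 0 := fun i => by
    simpa using ENNReal.tsum_eq_zero.1 h1 i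
  have h3 : c = 0 := by
    ext v
    have := tsum_enorm_inner_sq (onb H) (c v)
    rw [← hs] at this
    simp_rw [ContinuousLinearMap.star_eq_adjoint, ContinuousLinearMap.adjoint_inner_right,
      h2, inner_zero_left] at this
    rw [← ContinuousLinearMap.star_eq_adjoint, hs] at this
    have h4 : ‖c v‖ₑ ^ 2 = 0 := by simpa using this.symm
    simpa using h4
  rw [h, h3, mul_zero]

end TraceClass

end TraceDist

namespace TraceDist

/-! ### Weak compactness of the unit ball and its extreme points -/

section UnitBall

open scoped InnerProductSpace Topology

variable {H : Type*} [NormedAddCommGroup H] [InnerProductSpace ℂ H]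

/-- The closed unit ball of `B(H)`, as a set in the weak operator topology. -/
def wotBall (H : Type*) [NormedAddCommGroup H] [InnerProductSpace ℂ H] : Set (H →WOT[ℂ] H) :=
  {A | ‖A.toCLM‖ ≤ 1}

/-- The instances are those of an abstract real vector space. -/
theorem convex_wotBall : @Convex ℝ (H →WOT[ℂ] H) _ _ AddCommGroup.toAddCommMonoid
    (Module.toDistribMulAction.toDistribSMul.toSMul) (wotBall H) := by
  intro A hA B hB s t hs ht hst
  have h := convex_closedBall (0 : H →L[ℂ] H) 1 (mem_closedBall_zero_iff.2 hA)
    (mem_closedBall_zero_iff.2 hB) hs ht hst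
  exact mem_closedBall_zero_iff.1 h

variable [CompleteSpace H]

/-- Along an ultrafilter each coefficient ⟨Av, w⟩ converges in a closed disc; the limits form a
bounded sesquilinear form, hence an operator. -/
theorem isCompact_wotBall : IsCompact (wotBall H) := by
  rw [isCompact_iff_ultrafilter_le_nhds]
  intro U hU
  have hb : ∀ᶠ A : H →WOT[ℂ] H in U, ‖A.toCLM‖ ≤ 1 := Filter.le_principal_iff.1 hU
  have hex : ∀ v w : H, ∃ l : ℂ, ‖l‖ ≤ ‖v‖ * ‖w‖ ∧
      Filter.Tendsto (fun A : H →WOT[ℂ] H => ⟪A v, w⟫_ℂ) U (𝓝 l) := fun v w => by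
    have hK := isCompact_closedBall (0 : ℂ) (‖v‖ * ‖w‖)
    rw [isCompact_iff_ultrafilter_le_nhds] at hK
    obtain ⟨l, hl, hlim⟩ := hK (U.map fun A : H →WOT[ℂ] H => ⟪A v, w⟫_ℂ) (by
      rw [Filter.le_principal_iff]
      refine hb.mono fun A hA => ?_
      rw [Metric.mem_closedBall, dist_zero_right, norm_inner_symm]
      refine (norm_inner_apply_le hA w v).trans_eq ?_
      ring)
    exact ⟨l, by simpa using hl, hlim⟩
  choose l hl hlim using hex
  let B : H →ₗ⋆[ℂ] H →ₗ[ℂ] ℂ := LinearMap.mk₂'ₛₗ (starRingEnd ℂ) (RingHom.id ℂ) l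
    (fun v v' w => tendsto_nhds_unique (hlim _ _) (((hlim v w).add (hlim v' w)).congr fun A => by
      rw [← inner_add_left, map_add]))
    (fun z v w => tendsto_nhds_unique (hlim _ _) (((hlim v w).const_mul _).congr fun A => by
      rw [map_smul, inner_smul_left]))
    (fun v w w' => tendsto_nhds_unique (hlim _ _) (((hlim v w).add (hlim v w')).congr fun A => by
      rw [← inner_add_right]))
    (fun z v w => tendsto_nhds_unique (hlim _ _) (((hlim v w).const_mul _).congr fun A => by
      rw [inner_smul_right, RingHom.id_apply]))
  let T : H →L[ℂ] H := InnerProductSpace.continuousLinearMapOfBilin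
    (B.mkContinuous₂ 1 fun v w => by simpa [B] using hl v w)
  have hT : ∀ v w, ⟪T v, w⟫_ℂ = l v w := fun v w => by
    simp [T, B]
  refine ⟨ContinuousLinearMapWOT.ofCLM T, ?_, ?_⟩
  · refine T.opNorm_le_bound zero_le_one fun v => ?_
    have h1 : ‖T v‖ * ‖T v‖ ≤ ‖v‖ * ‖T v‖ := by
      have := hl v (T v)
      rw [← hT, inner_self_eq_norm_sq_to_K] at this
      simpa [sq] using this
    rw [one_mul]
    by_contra! hlt
    exact absurd h1 (not_le.2 (mul_lt_mul_of_pos_right hlt ((norm_nonneg v).trans_lt hlt)))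
  · refine ContinuousLinearMapWOT.le_nhds_iff_forall_inner_apply_le_nhds.2 fun v w => ?_
    have h := (Complex.continuous_conj.tendsto _).comp (hlim v w)
    rw [← hT, inner_conj_symm] at h
    refine Filter.Tendsto.congr (fun A => ?_) h
    exact inner_conj_symm _ _

/-- On the ball the trace is a series of continuous coefficients dominated by the summable ‖fᵢ‖‖gᵢ‖.
-/
theorem IsTraceClass.continuousOn_trace_mul {x : H →L[ℂ] H} (hx : IsTraceClass x) :
    ContinuousOn (fun A : H →WOT[ℂ] H => trace (A.toCLM * x)) (wotBall H) := by
  obtain ⟨f, g, hs, -, htr⟩ := hx.exists_trace_mul_eq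
  simp_rw [htr]
  refine continuousOn_tsum (fun i => ?_) hs fun i A hA => ?_
  · exact ContinuousLinearMapWOT.continuousOn_inner_apply continuousOn_id (g i) (f i)
  · simpa using norm_inner_apply_le hA (f i) (g i)

theorem eq_zero_of_add_mem_of_sub_mem {X : Type*} [AddCommGroup X] [Module ℝ X] {S : Set X}
    {a b : X} (ha : a ∈ S.extremePoints ℝ) (h1 : a + b ∈ S) (h2 : a - b ∈ S) : b = 0 := by
  have := ha.2 h1 h2 ⟨1 / 2, 1 / 2, by norm_num, by norm_num, by norm_num, by module⟩
  simpa using this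

theorem norm_le_one_iff_star_mul_le_one {a : H →L[ℂ] H} : ‖a‖ ≤ 1 ↔ star a * a ≤ 1 := by
  rw [← CStarAlgebra.norm_le_one_iff_of_nonneg _ (star_mul_self_nonneg a),
    CStarRing.norm_star_mul_self, ← sq, sq_le_one_iff₀ (norm_nonneg a)]

/-- With s = 1 - a*a, both a ± ½as are contractions, so extremality kills as. Thus `a` is a partial
isometry. -/
theorem mul_eq_zero_of_extreme {a : H →L[ℂ] H} (ha : ‖a‖ ≤ 1)
    (hext : ∀ b : H →L[ℂ] H, ‖a + b‖ ≤ 1 → ‖a - b‖ ≤ 1 → b = 0) :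
    a * (1 - star a * a) = 0 := by
  set s : H →L[ℂ] H := 1 - star a * a with hs
  have hs0 : 0 ≤ s := sub_nonneg.2 (norm_le_one_iff_star_mul_le_one.1 ha)
  have hss : star s = s := (IsSelfAdjoint.of_nonneg hs0).star_eq
  have h := hext ((1 / 2 : ℝ) • (a * s)) ?_ ?_
  · simpa using h
  · rw [norm_le_one_iff_star_mul_le_one, ← sub_nonneg]
    -- Since a*a = 1 - s, the defect is 1 - (1 + s/2)(1 - s)(1 + s/2) = ¾s² + ¼s³.
    have h1 : 0 ≤ (3 / 4 : ℝ) • (star s * s) + (1 / 4 : ℝ) • (star s * s * s) :=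
      add_nonneg (smul_nonneg (by norm_num) (star_mul_self_nonneg s))
        (smul_nonneg (by norm_num) (star_left_conjugate_nonneg hs0 s))
    convert h1 using 1
    have h2 : star a * a = 1 - s := by rw [hs]; abel
    have h3 : star (a + (1 / 2 : ℝ) • (a * s)) * (a + (1 / 2 : ℝ) • (a * s)) =
        star a * a + (1 / 2 : ℝ) • (star a * a * s) + (1 / 2 : ℝ) • (s * (star a * a)) +
          (1 / 4 : ℝ) • (s * (star a * a) * s) := by
      simp only [star_add, star_smul, star_mul, hss, add_mul, mul_add, smul_mul_assoc,
        mul_smul_comm, mul_assoc, star_trivial, smul_add, smul_smul]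
      norm_num
      abel
    rw [h3, h2, hss]
    simp only [sub_mul, mul_sub, one_mul, mul_one, mul_assoc]
    module
  · have h1 : a - (1 / 2 : ℝ) • (a * s) = (1 / 2 : ℝ) • (a * (1 + star a * a)) := by
      rw [hs, mul_sub, mul_add, mul_one]
      module
    have h2 : ‖star a * a‖ ≤ 1 := by
      rw [CStarRing.norm_star_mul_self]
      exact mul_le_one₀ ha (norm_nonneg _) ha
    have h3 : ‖(1 : H →L[ℂ] H)‖ ≤ 1 := ContinuousLinearMap.norm_id_le
    rw [h1, norm_smul]
    calc ‖(1 / 2 : ℝ)‖ * ‖a * (1 + star a * a)‖ ≤ (1 / 2) * (1 * (1 + 1)) := by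
          have h4 : ‖a * (1 + star a * a)‖ ≤ 1 * (1 + 1) :=
            (norm_mul_le _ _).trans (mul_le_mul ha ((norm_add_le _ _).trans (add_le_add h3 h2))
              (norm_nonneg _) zero_le_one)
          have h5 : ‖(1 / 2 : ℝ)‖ = 1 / 2 := by norm_num
          rw [h5]
          gcongr
      _ = 1 := by norm_num

/-- Now s = 1 - a*a is a projection. A contraction d with a*d = 0 and ds = d satisfies (a ± d)*(a ±
d) = a*a + d*d ≤ a*a + s = 1, so extremality excludes a nonzero one. -/
theorem mul_mul_eq_zero_of_extreme {a : H →L[ℂ] H} (ha : ‖a‖ ≤ 1)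
    (hext : ∀ b : H →L[ℂ] H, ‖a + b‖ ≤ 1 → ‖a - b‖ ≤ 1 → b = 0) (c : H →L[ℂ] H) :
    (1 - a * star a) * c * (1 - star a * a) = 0 := by
  have h0 := mul_eq_zero_of_extreme ha hext
  set s : H →L[ℂ] H := 1 - star a * a with hs
  have hss : star s = s := by simp [hs]
  have hs2 : s * s = s := by
    nth_rewrite 1 [hs]
    rw [sub_mul, one_mul, mul_assoc, h0, mul_zero, sub_zero]
  have hq : star a * (1 - a * star a) = 0 := by
    have := congrArg star h0
    rw [star_mul, hss, star_zero, hs] at this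
    rw [← this]
    noncomm_ring
  by_contra hne
  set b := (1 - a * star a) * c * s with hb
  have key : ∀ d : H →L[ℂ] H, ‖d‖ ≤ 1 → star a * d = 0 → d * s = d → ‖a + d‖ ≤ 1 := by
    intro d hd had hds
    rw [norm_le_one_iff_star_mul_le_one]
    have hda : star d * a = 0 := by
      have := congrArg star had
      simpa using this
    calc star (a + d) * (a + d) = star a * a + star d * d := by
          rw [star_add, add_mul, mul_add, mul_add, had, hda, zero_add, add_zero]
      _ = star a * a + star s * (star d * d) * s := by
          rw [mul_assoc, mul_assoc (star d), hds, ← mul_assoc, ← star_mul, hds]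
      _ ≤ star a * a + star s * 1 * s := by
          gcongr
          exact star_left_conjugate_le_conjugate (norm_le_one_iff_star_mul_le_one.1 hd) s
      _ = 1 := by
          rw [hss, mul_one, hs2, hs]
          abel
  have hbn : 0 < ‖b‖ := norm_pos_iff.2 hne
  set d : H →L[ℂ] H := ‖b‖⁻¹ • b with hd
  have hdn : ‖d‖ ≤ 1 := by
    rw [hd, norm_smul, norm_inv, norm_norm, inv_mul_cancel₀ hbn.ne']
  have had : star a * d = 0 := by
    rw [hd, mul_smul_comm, hb, ← mul_assoc, ← mul_assoc, hq, zero_mul, zero_mul, smul_zero]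
  have hds : d * s = d := by
    rw [hd, smul_mul_assoc, hb, mul_assoc _ s s, hs2]
  have := hext d (key d hdn had hds) (by
    rw [sub_eq_add_neg]
    exact key (-d) (by rwa [norm_neg]) (by rw [mul_neg, had, neg_zero]) (by rw [neg_mul, hds]))
  exact hne ((smul_eq_zero.1 this).resolve_left (inv_ne_zero hbn.ne'))

/-- Extreme contractions of `B(H)` are isometries or co-isometries. -/
theorem isIsometryOrCoisometry_of_mem_extremePoints {A : H →WOT[ℂ] H}
    (hA : A ∈ (wotBall H).extremePoints ℝ) : IsIsometryOrCoisometry A.toCLM := by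
  have hz := mul_mul_eq_zero_of_extreme (a := A.toCLM) hA.1 fun b h1 h2 => by
    have := eq_zero_of_add_mem_of_sub_mem hA (b := ContinuousLinearMapWOT.ofCLM b) h1 h2
    exact congrArg ContinuousLinearMapWOT.toCLM this
  by_contra hcon
  rw [IsIsometryOrCoisometry, not_or] at hcon
  have h1 : 1 - star A.toCLM * A.toCLM ≠ 0 := fun h => hcon.1 (sub_eq_zero.1 h).symm
  have h2 : 1 - A.toCLM * star A.toCLM ≠ 0 := fun h => hcon.2 (sub_eq_zero.1 h).symm
  obtain ⟨v, hv⟩ := DFunLike.ne_iff.1 h1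
  obtain ⟨w, hw⟩ := DFunLike.ne_iff.1 h2
  -- For this rank-one operator, evaluation at `v` gives ‖(1 - a*a)v‖² (1 - aa*)w = 0.
  have := congrArg (fun m : H →L[ℂ] H => m v)
    (hz (InnerProductSpace.rankOne ℂ w ((1 - star A.toCLM * A.toCLM) v)))
  simp only [mul_apply_eq_comp, InnerProductSpace.rankOne_apply, map_smul,
    zero_apply, smul_eq_zero, inner_self_eq_zero] at this
  exact this.elim hv hw

end UnitBall

end TraceDist

namespace TraceDist

/-! ### Distance duality through the trace coordinates -/

section Duality

open scoped InnerProductSpace Topology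

variable {H : Type*} [NormedAddCommGroup H] [InnerProductSpace ℂ H]

theorem convex_compact_contractions :
    Convex ℝ {a : H →L[ℂ] H | IsCompactOperator a ∧ ‖a‖ ≤ 1} := by
  intro a ha c hc s t hs ht hst
  refine ⟨(ha.1.smul s).add (hc.1.smul t), ?_⟩
  have h := convex_closedBall (0 : H →L[ℂ] H) 1 (mem_closedBall_zero_iff.2 ha.2)
    (mem_closedBall_zero_iff.2 hc.2) hs ht hst
  exact mem_closedBall_zero_iff.1 h

variable [CompleteSpace H]

/-- The functional `a ↦ Tr (a x)`. -/
noncomputable def IsTraceClass.traceMul {x : H →L[ℂ] H} (hx : IsTraceClass x) :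
    (H →L[ℂ] H) →ₗ[ℂ] ℂ where
  toFun a := trace (a * x)
  map_add' := hx.trace_add_mul
  map_smul' z a := by rw [smul_mul_assoc, trace_smul, RingHom.id_apply, smul_eq_mul]

theorem IsTraceClass.traceMul_apply {x : H →L[ℂ] H} (hx : IsTraceClass x) (a : H →L[ℂ] H) :
    hx.traceMul a = trace (a * x) := rfl

/-- The real linear map `a ↦ ((Tr (a vⱼ))ⱼ, Re Tr (a x))`. -/
noncomputable def traceCoords {n : ℕ} {v : Fin n → H →L[ℂ] H} (hv : ∀ j, IsTraceClass (v j))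
    {x : H →L[ℂ] H} (hx : IsTraceClass x) : (H →L[ℂ] H) →ₗ[ℝ] (Fin n → ℂ) × ℝ :=
  (LinearMap.pi fun j => (hv j).traceMul.restrictScalars ℝ).prod
    (Complex.reLm ∘ₗ hx.traceMul.restrictScalars ℝ)

theorem traceCoords_apply {n : ℕ} {v : Fin n → H →L[ℂ] H} (hv : ∀ j, IsTraceClass (v j))
    {x : H →L[ℂ] H} (hx : IsTraceClass x) (a : H →L[ℂ] H) :
    traceCoords hv hx a = (fun j => trace (a * v j), (trace (a * x)).re) := rfl

theorem traceCoords_ofReal_smul {n : ℕ} {v : Fin n → H →L[ℂ] H} (hv : ∀ j, IsTraceClass (v j))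
    {x : H →L[ℂ] H} (hx : IsTraceClass x) (r : ℝ) (a : H →L[ℂ] H) :
    traceCoords hv hx ((r : ℂ) • a) = r • traceCoords hv hx a := by
  rw [traceCoords_apply, traceCoords_apply, Prod.smul_mk]
  refine Prod.ext (funext fun j => ?_) ?_
  · simp only [Pi.smul_apply, smul_mul_assoc, trace_smul, Complex.real_smul]
  · simp only [smul_mul_assoc, trace_smul, Complex.re_ofReal_mul, smul_eq_mul]

theorem convex_image_traceCoords {n : ℕ} {v : Fin n → H →L[ℂ] H} (hv : ∀ j, IsTraceClass (v j))
    {x : H →L[ℂ] H} (hx : IsTraceClass x) {S : Set (H →L[ℂ] H)} (hS : Convex ℝ S) :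
    Convex ℝ (traceCoords hv hx '' S) := by
  rintro _ ⟨a, ha, rfl⟩ _ ⟨c, hc, rfl⟩ s t hs ht hst
  exact ⟨s • a + t • c, hS ha hc hs ht hst, by rw [map_add, map_smul, map_smul]⟩

theorem isTraceClass_sum {ι : Type*} (s : Finset ι) {y : ι → H →L[ℂ] H}
    (hy : ∀ i, IsTraceClass (y i)) : IsTraceClass (∑ i ∈ s, y i) :=
  Finset.sum_induction _ _ (fun _ _ => IsTraceClass.add) isTraceClass_zero fun i _ => hy i

theorem trace_mul_sum {ι : Type*} (s : Finset ι) {y : ι → H →L[ℂ] H}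
    (hy : ∀ i, IsTraceClass (y i)) (a : H →L[ℂ] H) :
    trace (a * ∑ i ∈ s, y i) = ∑ i ∈ s, trace (a * y i) := by
  classical
  induction s using Finset.induction_on with
  | empty => simp [trace]
  | insert i s hi ih =>
    rw [Finset.sum_insert hi, Finset.sum_insert hi, trace_mul_add (hy i) (isTraceClass_sum s hy), ih]

/-- Real functionals on `ℂⁿ × ℝ` in coordinates. -/
theorem exists_functional_eq {n : ℕ} (f : (Fin n → ℂ) × ℝ →ₗ[ℝ] ℝ) :
    ∃ (α : Fin n → ℂ) (β : ℝ), ∀ z s, f (z, s) = (∑ j, α j * z j).re + β * s := by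
  let g : Fin n → ℂ →ₗ[ℝ] ℝ := fun j =>
    f ∘ₗ LinearMap.inl ℝ _ _ ∘ₗ LinearMap.single ℝ (fun _ : Fin n => ℂ) j
  have hg : ∀ j w, g j w = w.re * g j 1 + w.im * g j Complex.I := fun j w => by
    have h : w = w.re • (1 : ℂ) + w.im • Complex.I := by
      simp [Complex.re_add_im]
    conv_lhs => rw [h]
    simp only [map_add, map_smul, smul_eq_mul]
  -- A real functional g on ℂ is w ↦ Re((g(1) - i g(i)) w).
  refine ⟨fun j => ⟨g j 1, -g j Complex.I⟩, f (0, 1), fun z s => ?_⟩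
  have h1 : (z, s) = ∑ j, LinearMap.inl ℝ (Fin n → ℂ) ℝ
      (LinearMap.single ℝ (fun _ : Fin n => ℂ) j (z j)) + s • ((0 : Fin n → ℂ), (1 : ℝ)) := by
    rw [← map_sum]
    simp [Finset.univ_sum_single]
  have h2 : f (z, s) = ∑ j, g j (z j) + s * f (0, 1) := by
    rw [h1, map_add, map_sum, map_smul, smul_eq_mul]
    rfl
  rw [h2, Complex.re_sum, mul_comm s]
  congr 1
  refine Finset.sum_congr rfl fun j _ => ?_
  rw [hg, Complex.mul_re]
  ring

variable {V : Submodule ℂ (H →L[ℂ] H)} {x : H →L[ℂ] H}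

theorem traceDist_le {v : H →L[ℂ] H} (hv : v ∈ V) : traceDist x V ≤ traceNorm (x - v) :=
  ciInf_le (f := fun v : V => traceNorm (x - (v : H →L[ℂ] H)))
    ⟨0, by rintro _ ⟨w, rfl⟩; exact traceNorm_nonneg _⟩ ⟨v, hv⟩

theorem norm_trace_mul_le_traceDist (hV : ∀ v ∈ V, IsTraceClass v) (hx : IsTraceClass x)
    {a : H →L[ℂ] H} (ha : a ∈ traceAnnihilator V) :
    ‖trace (a * x)‖ ≤ ‖a‖ * traceDist x V := by
  rw [traceDist, Real.mul_iInf_of_nonneg (norm_nonneg a)]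
  refine le_ciInf fun v => ?_
  have hv : IsTraceClass (-(v : H →L[ℂ] H)) := hV _ (V.neg_mem v.2)
  have h1 : trace (a * x) = trace (a * (x + -(v : H →L[ℂ] H))) := by
    rw [trace_mul_add hx hv, ha _ (V.neg_mem v.2), add_zero]
  rw [h1, sub_eq_add_neg]
  exact (hx.add hv).norm_trace_mul_le a

/-- For β ≠ 0, v + βx is β times the difference of `x` and an element of `V`. -/
theorem abs_mul_traceDist_le (hV : ∀ v ∈ V, IsTraceClass v) (hx : IsTraceClass x)
    {v : H →L[ℂ] H} (hv : v ∈ V) (β : ℝ) :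
    |β| * traceDist x V ≤ traceNorm (v + (β : ℂ) • x) := by
  rcases eq_or_ne β 0 with rfl | hβ
  · simpa using traceNorm_nonneg v
  have hβ' : (β : ℂ) ≠ 0 := by exact_mod_cast hβ
  have h1 : x - -((β : ℂ)⁻¹ • v) = (β : ℂ)⁻¹ • (v + (β : ℂ) • x) := by
    rw [smul_add, inv_smul_smul₀ hβ', sub_neg_eq_add, add_comm]
  have h2 := traceDist_le (x := x) (V.neg_mem (V.smul_mem (β : ℂ)⁻¹ hv))
  rw [h1] at h2
  have h3 := h2.trans (((hV v hv).add (hx.smul β)).smul_and_traceNorm_le _).2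
  rw [norm_inv, Complex.norm_real, Real.norm_eq_abs] at h3
  have h4 : 0 < |β| := abs_pos.2 hβ
  calc |β| * traceDist x V ≤ |β| * (|β|⁻¹ * traceNorm (v + (β : ℂ) • x)) := by gcongr
    _ = _ := by rw [← mul_assoc, mul_inv_cancel₀ h4.ne', one_mul]

theorem mem_traceAnnihilator_iff {n : ℕ} (b : Module.Basis (Fin n) ℂ V)
    (hV : ∀ v ∈ V, IsTraceClass v) (a : H →L[ℂ] H) :
    a ∈ traceAnnihilator V ↔ ∀ j, trace (a * (b j : H →L[ℂ] H)) = 0 := by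
  refine ⟨fun h j => h _ (b j).2, fun h y hy => ?_⟩
  have h1 : y = ∑ j, b.repr ⟨y, hy⟩ j • (b j : H →L[ℂ] H) := by
    have := congrArg V.subtype (b.sum_repr ⟨y, hy⟩)
    rw [map_sum] at this
    exact this.symm
  rw [h1, trace_mul_sum _ fun j => (hV _ (b j).2).smul _]
  refine Finset.sum_eq_zero fun j _ => ?_
  rw [mul_smul_comm, trace_smul, h j, mul_zero]

theorem traceCoords_eq_iff {n : ℕ} (b : Module.Basis (Fin n) ℂ V) (hV : ∀ v ∈ V, IsTraceClass v)
    (hx : IsTraceClass x) (a : H →L[ℂ] H) (t : ℝ) :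
    traceCoords (fun j => hV _ (b j).2) hx a = (0, t) ↔
      a ∈ traceAnnihilator V ∧ (trace (a * x)).re = t := by
  rw [traceCoords_apply, Prod.mk.injEq, mem_traceAnnihilator_iff b hV, funext_iff]
  rfl

/-- A nonzero functional of the trace coordinates is the pairing with a nonzero operator in
`V + ℝ x`. -/
theorem exists_functional_traceCoords {n : ℕ} (b : Module.Basis (Fin n) ℂ V)
    (hV : ∀ v ∈ V, IsTraceClass v) (hx : IsTraceClass x) (hxV : x ∉ V)
    {f : (Fin n → ℂ) × ℝ →ₗ[ℝ] ℝ} (hf : f ≠ 0) :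
    ∃ v ∈ V, ∃ β : ℝ, v + (β : ℂ) • x ≠ 0 ∧ (∀ t, f (0, t) = β * t) ∧
      ∀ a, f (traceCoords (fun j => hV _ (b j).2) hx a) =
        (trace (a * (v + (β : ℂ) • x))).re := by
  obtain ⟨α, β, h⟩ := exists_functional_eq f
  have hmem : ∑ j, α j • (b j : H →L[ℂ] H) ∈ V :=
    V.sum_mem fun j _ => V.smul_mem _ (b j).2
  refine ⟨_, hmem, β, fun h0 => hf ?_, fun t => by simp [h], fun a => ?_⟩
  · have hβ : β = 0 := by
      by_contra hβ
      have hβ' : (β : ℂ) ≠ 0 := by exact_mod_cast hβ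
      refine hxV ((V.smul_mem_iff hβ').1 ?_)
      rw [eq_neg_of_add_eq_zero_right h0]
      exact V.neg_mem hmem
    rw [hβ, Complex.ofReal_zero, zero_smul, add_zero] at h0
    have hα : ∀ j, α j = 0 := by
      refine Fintype.linearIndependent_iff.1 b.linearIndependent α (Subtype.ext ?_)
      simpa using h0
    refine LinearMap.ext fun p => ?_
    rw [← Prod.mk.eta (p := p), h]
    simp [hα, hβ]
  · rw [traceCoords_apply, h, trace_mul_add (hV _ hmem) (hx.smul _),
      trace_mul_sum _ fun j => (hV _ (b j).2).smul _]
    simp only [mul_smul_comm, trace_smul, Complex.add_re, Complex.re_ofReal_mul]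

theorem IsIsometryOrCoisometry.norm_le_one {u : H →L[ℂ] H} (hu : IsIsometryOrCoisometry u) :
    ‖u‖ ≤ 1 := by
  rcases hu with h | h
  · exact norm_le_one_iff_star_mul_le_one.2 h.le
  · rw [← norm_star]
    refine norm_le_one_iff_star_mul_le_one.2 ?_
    rw [star_star]
    exact h.le

theorem trace_sum_smul_mul {k : ℕ} (lam : Fin k → ℝ) (u : Fin k → H →L[ℂ] H) {y : H →L[ℂ] H}
    (hy : IsTraceClass y) : ∑ i, (lam i : ℂ) * trace (u i * y) =
      trace ((∑ i, (lam i : ℂ) • u i) * y) := by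
  rw [← hy.traceMul_apply, map_sum]
  refine Finset.sum_congr rfl fun i _ => ?_
  rw [map_smul, hy.traceMul_apply, smul_eq_mul]

theorem norm_sum_smul_le_one {k : ℕ} {lam : Fin k → ℝ} (h0 : ∀ i, 0 ≤ lam i)
    (h1 : ∑ i, lam i = 1) {u : Fin k → H →L[ℂ] H} (hu : ∀ i, IsIsometryOrCoisometry (u i)) :
    ‖∑ i, (lam i : ℂ) • u i‖ ≤ 1 := by
  rw [← h1]
  refine norm_sum_le_of_le _ fun i _ => ?_
  rw [norm_smul, Complex.norm_real, Real.norm_of_nonneg (h0 i)]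
  exact mul_le_of_le_one_right (h0 i) (hu i).norm_le_one

/-- It suffices that some annihilating `a` has Re Tr(ax) = 1. Otherwise (0, 1) is separated from the
range of a linear map, and a functional bounded above on a subspace is ≤ 0 there, which forces y = v
+ βx to vanish. -/
theorem traceDist_pos {n : ℕ} (b : Module.Basis (Fin n) ℂ V)
    (hV : ∀ v ∈ V, IsTraceClass v) (hx : IsTraceClass x) (hxV : x ∉ V) :
    0 < traceDist x V := by
  suffices h : ∃ a : H →L[ℂ] H, a ∈ traceAnnihilator V ∧ (trace (a * x)).re = 1 by
    obtain ⟨a, ha, h1⟩ := h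
    have h2 := (Complex.re_le_norm _).trans (norm_trace_mul_le_traceDist hV hx ha)
    rw [h1] at h2
    exact pos_of_mul_pos_right (zero_lt_one.trans_le h2) (norm_nonneg a)
  by_contra hno
  have hp : ((0 : Fin _ → ℂ), (1 : ℝ)) ∉
      Set.range (traceCoords (fun j => hV _ (b j).2) hx) := by
    rintro ⟨a, ha⟩
    exact hno ⟨a, (traceCoords_eq_iff b hV hx a 1).1 ha⟩
  have hconv : Convex ℝ (Set.range (traceCoords (fun j => hV _ (b j).2) hx)) := by
    rw [← LinearMap.coe_range]
    exact Submodule.convex _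
  obtain ⟨f, hf0, hf⟩ := exists_ne_zero_forall_le_of_notMem hconv ⟨_, 0, rfl⟩ hp
  obtain ⟨v, hv, β, hy0, -, hfa⟩ := exists_functional_traceCoords b hV hx hxV hf0
  have hle : ∀ a : H →L[ℂ] H, (trace (a * (v + (β : ℂ) • x))).re ≤ 0 := by
    intro a
    by_contra! hpos
    obtain ⟨m, hm⟩ := exists_nat_gt (f (0, 1) / (trace (a * (v + (β : ℂ) • x))).re)
    have h1 := hf _ ⟨(m : ℝ) • a, rfl⟩
    rw [map_smul, map_smul, hfa, smul_eq_mul] at h1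
    rw [div_lt_iff₀ hpos] at hm
    exact absurd h1 (not_le.2 hm)
  obtain ⟨h1, h2⟩ := isTraceClass_and_traceNorm_le (C := 0) fun a _ _ => hle a
  exact hy0 (h1.eq_zero_of_traceNorm_le h2)

theorem exists_compact_mem_traceAnnihilator {n : ℕ} (b : Module.Basis (Fin n) ℂ V)
    (hV : ∀ v ∈ V, IsTraceClass v) (hx : IsTraceClass x) (hxV : x ∉ V)
    {t : ℝ} (ht0 : 0 ≤ t) (ht : t < traceDist x V) :
    ∃ a : H →L[ℂ] H, IsCompactOperator a ∧ ‖a‖ ≤ 1 ∧ a ∈ traceAnnihilator V ∧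
      (trace (a * x)).re = t := by
  by_contra hno
  have hp : ((0 : Fin _ → ℂ), t) ∉ traceCoords (fun j => hV _ (b j).2) hx ''
      {a : H →L[ℂ] H | IsCompactOperator a ∧ ‖a‖ ≤ 1} := by
    rintro ⟨a, ⟨hc, hn⟩, ha⟩
    exact hno ⟨a, hc, hn, (traceCoords_eq_iff b hV hx a t).1 ha⟩
  have hconv : Convex ℝ (traceCoords (fun j => hV _ (b j).2) hx ''
      {a : H →L[ℂ] H | IsCompactOperator a ∧ ‖a‖ ≤ 1}) :=
    convex_image_traceCoords _ hx convex_compact_contractions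
  obtain ⟨f, hf0, hf⟩ := exists_ne_zero_forall_le_of_notMem hconv
    (Set.Nonempty.image _ ⟨0, isCompactOperator_zero, by simp⟩) hp
  obtain ⟨v, hv, β, hy0, hft, hfa⟩ := exists_functional_traceCoords b hV hx hxV hf0
  obtain ⟨h1, h2⟩ := isTraceClass_and_traceNorm_le (x := v + (β : ℂ) • x) (C := β * t)
    fun a hc hn => by
      rw [← hfa, ← hft]
      exact hf _ ⟨a, ⟨hc, hn⟩, rfl⟩
  have h3 := (abs_mul_traceDist_le hV hx hv β).trans h2
  have h4 : β * t ≤ |β| * t := by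
    gcongr
    exact le_abs_self β
  -- For β = 0 the bound βt is 0 and contradicts y ≠ 0; otherwise t < dist gives the contradiction.
  rcases eq_or_ne β 0 with hβ | hβ
  · rw [hβ, zero_mul] at h2
    rw [hβ] at h1 hy0
    exact hy0 (h1.eq_zero_of_traceNorm_le h2)
  · exact (h3.trans h4).not_gt (mul_lt_mul_of_pos_left ht (abs_pos.2 hβ))

/-- The map `traceCoords`, on operators with the weak operator topology. -/
noncomputable def wotTraceCoords {n : ℕ} {v : Fin n → H →L[ℂ] H} (hv : ∀ j, IsTraceClass (v j))
    {x : H →L[ℂ] H} (hx : IsTraceClass x) : (H →WOT[ℂ] H) →ₗ[ℝ] (Fin n → ℂ) × ℝ where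
  toFun A := traceCoords hv hx A.toCLM
  map_add' A B := (traceCoords hv hx).map_add A.toCLM B.toCLM
  map_smul' t A := (traceCoords hv hx).map_smul t A.toCLM

theorem continuousOn_traceCoords {n : ℕ} {v : Fin n → H →L[ℂ] H} (hv : ∀ j, IsTraceClass (v j))
    {x : H →L[ℂ] H} (hx : IsTraceClass x) :
    ContinuousOn (wotTraceCoords hv hx) (wotBall H) :=
  (continuousOn_pi.2 fun j => (hv j).continuousOn_trace_mul).prodMk
    (Complex.continuous_re.comp_continuousOn hx.continuousOn_trace_mul)

/-- The image of the weakly compact ball is closed and contains (0, t) for 0 < t < dist, hence also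
the endpoint; compactness of the operator may be lost in the limit. -/
theorem exists_contraction_mem_traceAnnihilator {n : ℕ} (b : Module.Basis (Fin n) ℂ V)
    (hV : ∀ v ∈ V, IsTraceClass v) (hx : IsTraceClass x) (hxV : x ∉ V) :
    ∃ a : H →L[ℂ] H, ‖a‖ ≤ 1 ∧ a ∈ traceAnnihilator V ∧
      (trace (a * x)).re = traceDist x V := by
  have hd := traceDist_pos b hV hx hxV
  have hclosed := (isCompact_wotBall.image_of_continuousOn
    (continuousOn_traceCoords (fun j => hV _ (b j).2) hx)).isClosed
  have hpre := hclosed.preimage (f := fun t : ℝ => ((0 : Fin _ → ℂ), t)) (by fun_prop)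
  have hmem := closure_minimal (s := Set.Ioo 0 (traceDist x V)) (fun t ht => by
    obtain ⟨a, -, hn, ha⟩ := exists_compact_mem_traceAnnihilator b hV hx hxV ht.1.le ht.2
    exact ⟨ContinuousLinearMapWOT.ofCLM a, hn, (traceCoords_eq_iff b hV hx a t).2 ha⟩) hpre
  rw [closure_Ioo hd.ne] at hmem
  obtain ⟨A, hA, h⟩ := hmem ⟨hd.le, le_rfl⟩
  exact ⟨A.toCLM, hA, (traceCoords_eq_iff b hV hx _ _).1 h⟩

theorem isLUB_compact {n : ℕ} (b : Module.Basis (Fin n) ℂ V)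
    (hV : ∀ v ∈ V, IsTraceClass v) (hx : IsTraceClass x) (hxV : x ∉ V) :
    IsLUB {r : ℝ | ∃ a : H →L[ℂ] H, IsCompactOperator a ∧ a ∈ traceAnnihilator V ∧
      ‖a‖ = 1 ∧ r = ‖trace (a * x)‖} (traceDist x V) := by
  have hd := traceDist_pos b hV hx hxV
  refine ⟨?_, fun B hB => le_of_forall_lt_imp_le_of_dense fun t ht => ?_⟩
  · rintro _ ⟨a, -, ha, hn, rfl⟩
    simpa [hn] using norm_trace_mul_le_traceDist hV hx ha
  -- A positive target value ensures a ≠ 0, so `a` can be normalised, which does not decrease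
  -- |Tr(ax)|.
  have ht1 : max t (traceDist x V / 2) < traceDist x V := max_lt ht (half_lt_self hd)
  have ht0 : 0 < max t (traceDist x V / 2) := lt_max_of_lt_right (half_pos hd)
  refine (le_max_left t (traceDist x V / 2)).trans ?_
  obtain ⟨a, hc, hn, ha, h⟩ := exists_compact_mem_traceAnnihilator b hV hx hxV ht0.le ht1
  have ha0 : a ≠ 0 := by
    rintro rfl
    simp [trace] at h
    exact ht0.ne h
  have hpos : 0 < ‖a‖ := norm_pos_iff.2 ha0
  have hnorm : ‖((‖a‖⁻¹ : ℝ) : ℂ)‖ = ‖a‖⁻¹ := by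
    rw [Complex.norm_real, norm_inv, norm_norm]
  have htr : ∀ y, trace ((((‖a‖⁻¹ : ℝ) : ℂ) • a) * y) = ((‖a‖⁻¹ : ℝ) : ℂ) * trace (a * y) :=
    fun y => by rw [smul_mul_assoc, trace_smul]
  have := hB ⟨((‖a‖⁻¹ : ℝ) : ℂ) • a, hc.smul _, fun y hy => by rw [htr, ha y hy, mul_zero],
    by rw [norm_smul, hnorm, inv_mul_cancel₀ hpos.ne'], rfl⟩
  refine le_trans ?_ this
  rw [htr, norm_mul, hnorm, ← h]
  calc (trace (a * x)).re ≤ 1 * ‖trace (a * x)‖ := by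
        rw [one_mul]
        exact Complex.re_le_norm _
    _ ≤ _ := by
      gcongr
      exact (one_le_inv₀ hpos).2 hn

theorem isGreatest_bounded {n : ℕ} (b : Module.Basis (Fin n) ℂ V)
    (hV : ∀ v ∈ V, IsTraceClass v) (hx : IsTraceClass x) (hxV : x ∉ V) :
    IsGreatest {r : ℝ | ∃ a : H →L[ℂ] H, a ∈ traceAnnihilator V ∧
      ‖a‖ = 1 ∧ r = ‖trace (a * x)‖} (traceDist x V) := by
  have hd := traceDist_pos b hV hx hxV
  constructor
  · obtain ⟨a, hn, ha, h⟩ := exists_contraction_mem_traceAnnihilator b hV hx hxV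
    have h1 := norm_trace_mul_le_traceDist hV hx ha
    have h2 := Complex.re_le_norm (trace (a * x))
    rw [h] at h2
    have hn1 : ‖a‖ = 1 := by
      refine le_antisymm hn (le_of_mul_le_mul_right ?_ hd)
      rw [one_mul]
      exact h2.trans h1
    rw [hn1, one_mul] at h1
    exact ⟨a, ha, hn1, le_antisymm h2 h1⟩
  · rintro _ ⟨a, ha, hn, rfl⟩
    simpa [hn] using norm_trace_mul_le_traceDist hV hx ha

/-- The trace distance is attained at a convex combination of few isometries and co-isometries. -/
theorem exists_weights_extremePoints {n : ℕ} (b : Module.Basis (Fin n) ℂ V)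
    (hV : ∀ v ∈ V, IsTraceClass v) (hx : IsTraceClass x) (hxV : x ∉ V) :
    ∃ (k : ℕ) (lam : Fin k → ℝ) (u : Fin k → H →L[ℂ] H), k ≤ 2 * n + 1 ∧
      (∀ i, 0 < lam i) ∧ ∑ i, lam i = 1 ∧ (∀ i, IsIsometryOrCoisometry (u i)) ∧
      ∑ i, (lam i : ℂ) • u i ∈ traceAnnihilator V ∧
      (trace ((∑ i, (lam i : ℂ) • u i) * x)).re = traceDist x V := by
  have hd := traceDist_pos b hV hx hxV
  set L := traceCoords (fun j => hV _ (b j).2) hx with hL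
  obtain ⟨a, hn, ha⟩ := exists_contraction_mem_traceAnnihilator b hV hx hxV
  have hLa := (traceCoords_eq_iff b hV hx a _).2 ha
  have hp : ((0 : Fin _ → ℂ), traceDist x V) ∉ L '' Metric.ball 0 1 := by
    rintro ⟨c, hc, h⟩
    obtain ⟨hcV, hcx⟩ := (traceCoords_eq_iff b hV hx c _).1 h
    have h1 := (Complex.re_le_norm _).trans (norm_trace_mul_le_traceDist hV hx hcV)
    rw [hcx] at h1
    exact h1.not_gt (mul_lt_of_lt_one_left hd (mem_ball_zero_iff.1 hc))
  have hconv : Convex ℝ (L '' Metric.ball 0 1) :=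
    convex_image_traceCoords _ hx (convex_ball _ _)
  obtain ⟨f, hf0, hf⟩ := exists_ne_zero_forall_le_of_notMem hconv
    (Set.Nonempty.image _ ⟨0, by simp⟩) hp
  -- The bound passes from the open to the closed ball by scaling with r ↑ 1.
  have hf' : ∀ c : H →L[ℂ] H, ‖c‖ ≤ 1 → f (L c) ≤ f (L a) := fun c hc => by
    rw [hLa]
    have hcont : Continuous fun r : ℝ => r * f (L c) := by fun_prop
    have hlim : Filter.Tendsto (fun r : ℝ => r * f (L c)) (𝓝[<] 1) (𝓝 (f (L c))) := by
      simpa using (hcont.tendsto 1).mono_left nhdsWithin_le_nhds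
    refine le_of_tendsto hlim ?_
    filter_upwards [Ioo_mem_nhdsLT (zero_lt_one' ℝ)] with r hr
    have := hf _ ⟨r • c, ?_, rfl⟩
    · simpa using this
    · rw [mem_ball_zero_iff, norm_smul, Real.norm_of_nonneg hr.1.le]
      exact (mul_le_of_le_one_right hr.1.le hc).trans_lt hr.2
  obtain ⟨k, lam, u, hk, hpos, hsum, hu, heq⟩ := exists_sum_extremePoints_of_supporting
    isCompact_wotBall convex_wotBall
    (wotTraceCoords (fun j => hV _ (b j).2) hx)
    (continuousOn_traceCoords (fun j => hV _ (b j).2) hx)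
    (s₀ := ContinuousLinearMapWOT.ofCLM a) hn hf0 fun s hs => hf' _ hs
  have hdim : Module.finrank ℝ ((Fin n → ℂ) × ℝ) =
      2 * n + 1 := by
    simp [Module.finrank_prod, Module.finrank_pi_fintype, mul_comm]
  have hLb : L (∑ i, (lam i : ℂ) • (u i).toCLM) = (0, traceDist x V) := by
    rw [← hLa, map_sum, ← hL]
    refine Eq.trans (Finset.sum_congr rfl fun i _ => ?_) heq
    exact traceCoords_ofReal_smul _ hx _ _
  exact ⟨k, lam, fun i => (u i).toCLM, hdim ▸ hk, hpos, hsum,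
    fun i => isIsometryOrCoisometry_of_mem_extremePoints (hu i),
    (traceCoords_eq_iff b hV hx _ _).1 hLb⟩

end Duality

end TraceDist

theorem mainTheorem3 {H : Type*} [NormedAddCommGroup H] [InnerProductSpace ℂ H]
    [CompleteSpace H] (n : ℕ) (V : Submodule ℂ (H →L[ℂ] H)) [FiniteDimensional ℂ V]
    (hn : Module.finrank ℂ V = n) (hV : ∀ v ∈ V, TraceDist.IsTraceClass v)
    (x : H →L[ℂ] H) (hx : TraceDist.IsTraceClass x) (hxV : x ∉ V) :
    IsLUB {r : ℝ | ∃ a : H →L[ℂ] H, IsCompactOperator a ∧ a ∈ TraceDist.traceAnnihilator V ∧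
        ‖a‖ = 1 ∧ r = ‖TraceDist.trace (a * x)‖} (TraceDist.traceDist x V) ∧
    IsGreatest {r : ℝ | ∃ a : H →L[ℂ] H, a ∈ TraceDist.traceAnnihilator V ∧
        ‖a‖ = 1 ∧ r = ‖TraceDist.trace (a * x)‖} (TraceDist.traceDist x V) ∧
    ∃ (k : ℕ) (lam : Fin k → ℝ), 1 ≤ k ∧ k ≤ 2 * n + 1 ∧
      (∀ i, lam i ∈ Set.Icc (0 : ℝ) 1) ∧ ∑ i, lam i = 1 ∧
      IsGreatest {r : ℝ | ∃ u : Fin k → (H →L[ℂ] H),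
          (∀ i, TraceDist.IsIsometryOrCoisometry (u i)) ∧
          (∑ i, (lam i : ℂ) * TraceDist.trace (u i * x)).im = 0 ∧
          (∀ v ∈ V, ∑ i, (lam i : ℂ) * TraceDist.trace (u i * v) = 0) ∧
          r = (∑ i, (lam i : ℂ) * TraceDist.trace (u i * x)).re} (TraceDist.traceDist x V) := by
  let b := Module.finBasisOfFinrankEq ℂ V hn
  refine ⟨TraceDist.isLUB_compact b hV hx hxV, TraceDist.isGreatest_bounded b hV hx hxV, ?_⟩
  obtain ⟨k, lam, u, hk, hpos, hsum, hu, hb, hbx⟩ :=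
    TraceDist.exists_weights_extremePoints b hV hx hxV
  have hle : ∀ w : Fin k → (H →L[ℂ] H), (∀ i, TraceDist.IsIsometryOrCoisometry (w i)) →
      ∑ i, (lam i : ℂ) • w i ∈ TraceDist.traceAnnihilator V →
      ‖TraceDist.trace ((∑ i, (lam i : ℂ) • w i) * x)‖ ≤ TraceDist.traceDist x V :=
    fun w hw hwV => (TraceDist.norm_trace_mul_le_traceDist hV hx hwV).trans
      (mul_le_of_le_one_left (TraceDist.traceDist_pos b hV hx hxV).le
        (TraceDist.norm_sum_smul_le_one (fun i => (hpos i).le) hsum hw))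
  refine ⟨k, lam, ?_, hk, fun i => ⟨(hpos i).le, ?_⟩, hsum, ⟨u, hu, ?_, ?_, ?_⟩, ?_⟩
  · refine Nat.one_le_iff_ne_zero.2 ?_
    rintro rfl
    simp at hsum
  · rw [← hsum]
    exact Finset.single_le_sum (fun j _ => (hpos j).le) (Finset.mem_univ i)
  · rw [TraceDist.trace_sum_smul_mul lam u hx]
    -- Here |Tr(·x)| ≤ dist = Re Tr(·x), so the imaginary part vanishes.
    have h1 := hle u hu hb
    rw [← hbx] at h1
    exact Complex.abs_re_eq_norm.1
      (le_antisymm (Complex.abs_re_le_norm _) (h1.trans (le_abs_self _)))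
  · intro v hv
    rw [TraceDist.trace_sum_smul_mul lam u (hV v hv)]
    exact hb v hv
  · rw [TraceDist.trace_sum_smul_mul lam u hx, hbx]
  · rintro _ ⟨w, hw, -, hwV, rfl⟩
    rw [TraceDist.trace_sum_smul_mul lam w hx]
    refine (Complex.re_le_norm _).trans (hle w hw fun v hv => ?_)
    rw [← TraceDist.trace_sum_smul_mul lam w (hV v hv)]
    exact hwV v hv
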